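/- Let $(D,\mu)$ be a measure space. Write $\|f\|_2=(\int_D|f|^2\,d\mu)^{1/2}$ and let $L_2(D,\mu)$ denote the space of complex-valued square-integrable functions on $D$ (functions, not equivalence classes). Let $m\ge 1$ and let $V_m\subset L_2(D,\mu)$ be an $m$-dimensional space of functions. Let $H\neq\{0\}$ be a reproducing kernel Hilbert space of complex-valued functions on $D$ (a Hilbert space of functions on which all point evaluations are continuous) with reproducing kernel $K$, such that $H\subset L_2(D,\mu)$, the embedding is continuous, $$\lambda:=\sup_{f\in H\setminus\{0\}}\frac{\|f\|_2^2}{\|f\|_H^2}<\infty,$$ and injective, i.e. $\|f\|_2\neq 0$ for all $f\in H\setminus\{0\}$, and such that $x\mapsto K(x,x)$ is integrable, i.e. the kernel has finite trace $$\operatorname{Tr}(K):=\int_D K(x,x)\,d\mu(x)<\infty.$$ Put $M:=\operatorname{Tr}(K)/\lambda$. Then for every integer $n\ge m$ there exist points $x_1,\dots,x_n\in D$ and weights $w_1,\dots,w_n>0$ such that simultaneously $$\left(1-\sqrt{\frac{m-1}{n}}\right)\|f\|_2\;\le\;\sqrt{\sum_{i=1}^n w_i|f(x_i)|^2}\qquad\text{for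 all } f\in V_m$$ and $$\sqrt{\sum_{i=1}^n w_i|g(x_i)|^2}\;\le\;\left(1+\sqrt{\frac{M-1}{n}}\right)\sqrt{\lambda}\,\|g\|_H\qquad\text{for all } g\in H.$$ -/

import Mathlib

open MeasureTheory

noncomputable section

/-- The `L₂(D, μ)` (semi)norm of a complex-valued function on `D`; it is only used for functions
that are square-integrable (`MemLp f 2 μ`). Functions are not identified when they agree a.e. -/
def normL2 {D : Type*} [MeasurableSpace D] (μ : Measure D) (f : D → ℂ) : ℝ :=
  (eLpNorm f 2 μ).toReal

section RKHSQuantities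

variable {D : Type*} (H : Type*) [NormedAddCommGroup H] [InnerProductSpace ℂ H]
  [RKHS ℂ H D ℂ]

/-- The diagonal `x ↦ K(x, x)` of the reproducing kernel `K` of `H`. Mathlib's `RKHS.kernel H x y`
is the linear map `ℂ → ℂ` that multiplies by `K(x, y)`; the value `K(x, x)` is real. -/
def kernelDiag [CompleteSpace H] (x : D) : ℝ := (RKHS.kernel H x x (1 : ℂ)).re

/-- The trace `Tr(K) = ∫ K(x, x) dμ(x)`; it is only used when `K(x, x)` is integrable. -/
def kernelTrace [CompleteSpace H] [MeasurableSpace D] (μ : Measure D) : ℝ :=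
  ∫ x, kernelDiag H x ∂μ

/-- The quotients `‖f‖₂² / ‖f‖_H²` over all nonzero `f ∈ H`. -/
def embeddingRatios [MeasurableSpace D] (μ : Measure D) : Set ℝ :=
  {r | ∃ f : H, f ≠ 0 ∧ r = normL2 μ f ^ 2 / ‖f‖ ^ 2}

/-- `λ = sup_{f ∈ H, f ≠ 0} ‖f‖₂² / ‖f‖_H²`, the squared norm of the embedding `H → L₂(D, μ)`;
it is only used when the set of quotients is nonempty and bounded. -/
def embeddingConst [MeasurableSpace D] (μ : Measure D) : ℝ := sSup (embeddingRatios H μ)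

/-- The effective dimension `M = Tr(K) / λ` of `H` in `L₂(D, μ)`. -/
def effectiveDim [CompleteSpace H] [MeasurableSpace D] (μ : Measure D) : ℝ :=
  kernelTrace H μ / embeddingConst H μ

end RKHSQuantities

end

/-! This is the Batson–Spielman–Srivastava barrier method, run at once for two vector families over
the same points: `a x`, representing evaluation on the image of `V` in L², with `∫ a aᴴ = 1`; and `v
x = λ^(-1/2) K(·, x)` in `H`, whose second moment `T = ∫ v vᴴ` is injective, at most `1`, and of
trace `M`. Up to normalising the weights by `n`, one needs `∑ w a aᴴ ≥ n (1 - √((m-1)/n))²` and `∑ w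
v vᴴ ≤ n (1 + √((M-1)/n))²`.

Points are added greedily. For the next point `x` with weight `1/z`, the upper side tolerates every
`z ≥ U x` and the lower side every `z ≤ L x`, where `∫ U ≤ 1 ≤ ∫ L`. Hence `U x ≤ L x` with `L x >
0` for some `x`, and `z = L x` serves both (`exists_list_of_strategies`).

Each side keeps a positive invertible operator `P` with potential `∫ ⟪v, P⁻¹ v⟫ ≤ ε` (on the lower
side with `a` for `v`). Above, `P` is a barrier minus the frame operator, and the barrier advances
by multiples of `T` rather than of `1`, so that only the trace of `T` enters and `H` may be
infinite-dimensional (`barrier_isUpperStrategy`). Below, `P` is the frame operator minus a multiple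
of `1` (`barrier_isLowerStrategy`). Sherman–Morrison gives the exact change of the potential. At the
end the potential bound is used once more, as the operator inequality `∫ v vᴴ ≤ ε P`
(`IsPosInverse.integral_norm_inner_sq_le`); this gives the sharp `m - 1` and `M - 1`. -/

open MeasureTheory
open InnerProductSpace (rankOne)

/-! ### Positive operators with bounded inverse -/

section PositiveOperators

variable {E : Type*} [NormedAddCommGroup E] [InnerProductSpace ℂ E]

/-- The real quadratic form `x ↦ Re ⟪x, A x⟫` of an operator. -/
noncomputable def quadForm (A : E →L[ℂ] E) (x : E) : ℝ := (inner ℂ x (A x)).re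

lemma quadForm_add (A B : E →L[ℂ] E) (x : E) :
    quadForm (A + B) x = quadForm A x + quadForm B x := by
  simp [quadForm]

lemma quadForm_sub (A B : E →L[ℂ] E) (x : E) :
    quadForm (A - B) x = quadForm A x - quadForm B x := by
  simp [quadForm]

lemma quadForm_smul (c : ℝ) (A : E →L[ℂ] E) (x : E) :
    quadForm ((c : ℂ) • A) x = c * quadForm A x := by
  simp [quadForm]

lemma quadForm_rankOne (v x : E) : quadForm (rankOne ℂ v v) x = ‖inner ℂ v x‖ ^ 2 := by
  rw [quadForm, InnerProductSpace.rankOne_apply, inner_smul_right, ← inner_conj_symm x v,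
    Complex.mul_conj, Complex.ofReal_re, Complex.normSq_eq_norm_sq]

lemma quadForm_one (x : E) : quadForm (1 : E →L[ℂ] E) x = ‖x‖ ^ 2 := by
  simpa [quadForm] using inner_self_eq_norm_sq (𝕜 := ℂ) x

lemma ContinuousLinearMap.IsPositive.quadForm_nonneg {A : E →L[ℂ] E} (hA : A.IsPositive) (x : E) :
    0 ≤ quadForm A x := hA.re_inner_nonneg_right x

lemma ContinuousLinearMap.IsPositive.inner_comm {A : E →L[ℂ] E} (hA : A.IsPositive) (x y : E) :
    inner ℂ (A x) y = inner ℂ x (A y) := hA.inner_left_eq_inner_right x y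

/-- The Cauchy-Schwarz inequality for the form of a positive operator. -/
lemma ContinuousLinearMap.IsPositive.norm_inner_sq_le {A : E →L[ℂ] E} (hA : A.IsPositive)
    (x y : E) : ‖inner ℂ x (A y)‖ ^ 2 ≤ quadForm A x * quadForm A y := by
  let c : PreInnerProductSpace.Core ℂ E :=
    { inner := fun x y => inner ℂ x (A y)
      conj_inner_symm := fun x y => by
        change (starRingEnd ℂ) (inner ℂ y (A x)) = inner ℂ x (A y)
        rw [inner_conj_symm, hA.inner_comm]
      re_inner_nonneg := fun x => hA.re_inner_nonneg_right x
      add_left := fun x y z => inner_add_left _ _ _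
      smul_left := fun x y r => inner_smul_left _ _ _ }
  have h : ‖inner ℂ x (A y)‖ * ‖inner ℂ y (A x)‖ ≤ quadForm A x * quadForm A y :=
    @InnerProductSpace.Core.inner_mul_inner_self_le ℂ E _ _ _ c x y
  have h2 : ‖inner ℂ y (A x)‖ = ‖inner ℂ x (A y)‖ := by
    rw [← hA.inner_comm, norm_inner_symm]
  rwa [h2, ← sq] at h

lemma isPositive_of_inner_comm {A : E →L[ℂ] E} (h : ∀ x y, inner ℂ (A x) y = inner ℂ x (A y))
    (h0 : ∀ x, 0 ≤ quadForm A x) : A.IsPositive := by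
  refine ⟨fun x y => h x y, fun x => ?_⟩
  have := h0 x
  rw [quadForm, ← h] at this
  exact this

/-- `P` is a positive operator with bounded inverse `R`. -/
structure IsPosInverse (P R : E →L[ℂ] E) : Prop where
  pos : P.IsPositive
  apply_inv : ∀ x, P (R x) = x
  inv_apply : ∀ x, R (P x) = x

namespace IsPosInverse

variable {P R : E →L[ℂ] E}

lemma symm (h : IsPosInverse P R) : IsPosInverse R P := by
  refine ⟨isPositive_of_inner_comm (fun x y => ?_) (fun x => ?_), h.inv_apply, h.apply_inv⟩
  · conv_lhs => rw [← h.apply_inv y, ← h.pos.inner_comm, h.apply_inv]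
  · have := h.pos.quadForm_nonneg (R x)
    rw [quadForm, ← h.pos.inner_comm, h.apply_inv] at this
    exact this

/-- Cauchy–Schwarz for the form of `R`, applied to `x` and `P y`. -/
lemma norm_inner_sq_le (h : IsPosInverse P R) (x y : E) :
    ‖inner ℂ x y‖ ^ 2 ≤ quadForm R x * quadForm P y := by
  have := h.symm.pos.norm_inner_sq_le x (P y)
  rw [h.inv_apply] at this
  refine this.trans_eq ?_
  congr 1
  rw [quadForm, h.inv_apply, h.pos.inner_comm, quadForm]

lemma quadForm_le (A : E →L[ℂ] E) (x : E) : quadForm A x ≤ ‖A‖ * ‖x‖ ^ 2 := by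
  calc quadForm A x ≤ ‖inner ℂ x (A x)‖ := Complex.re_le_norm _
    _ ≤ ‖x‖ * ‖A x‖ := norm_inner_le_norm _ _
    _ ≤ ‖x‖ * (‖A‖ * ‖x‖) := by gcongr; exact A.le_opNorm x
    _ = _ := by ring

/-- Taking `y = x` in the previous inequality gives `‖x‖⁴ ≤ ‖R‖ ‖x‖² ⟪x, P x⟫`. -/
lemma coercive (h : IsPosInverse P R) : ∃ c > 0, ∀ x, c * ‖x‖ ^ 2 ≤ quadForm P x := by
  refine ⟨(‖R‖ + 1)⁻¹, by positivity, fun x => ?_⟩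
  rw [inv_mul_le_iff₀ (by positivity)]
  have h1 := h.norm_inner_sq_le x x
  have h2 := quadForm_le R x
  have h3 := h.pos.quadForm_nonneg x
  rw [inner_self_eq_norm_sq_to_K, norm_pow] at h1
  simp only [Complex.coe_algebraMap, Complex.norm_real, norm_norm] at h1
  rcases eq_or_ne x 0 with rfl | hx
  · simp [quadForm]
  have hx : 0 < ‖x‖ ^ 2 := by positivity
  have : ‖x‖ ^ 2 * ‖x‖ ^ 2 ≤ ‖x‖ ^ 2 * ((‖R‖ + 1) * quadForm P x) := by
    nlinarith [mul_le_mul_of_nonneg_right h2 h3, mul_nonneg hx.le h3]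
  exact le_of_mul_le_mul_left this hx

lemma exists_of_coercive [CompleteSpace E] {A : E →L[ℂ] E} (hA : A.IsPositive) {c : ℝ} (hc : 0 < c)
    (h : ∀ x, c * ‖x‖ ^ 2 ≤ quadForm A x) : ∃ R, IsPosInverse A R := by
  have hu : IsUnit A := by
    refine ContinuousLinearMap.isUnit_of_forall_le_norm_inner_map A (c := ⟨c, hc.le⟩) hc fun x => ?_
    rw [hA.inner_comm]
    calc ‖x‖ ^ 2 * c ≤ quadForm A x := by rw [mul_comm]; exact h x
      _ ≤ _ := Complex.re_le_norm _
  obtain ⟨u, rfl⟩ := hu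
  refine ⟨(u⁻¹ : (E →L[ℂ] E)ˣ), hA, fun x => ?_, fun x => ?_⟩
  · exact congrArg (fun B : E →L[ℂ] E => B x) u.mul_inv
  · exact congrArg (fun B : E →L[ℂ] E => B x) u.inv_mul

/-- The Sherman-Morrison formula. -/
lemma add_rankOne (h : IsPosInverse P R) (v : E) (t : ℝ) (ht : 0 < 1 + t * quadForm R v) :
    IsPosInverse (P + (t : ℂ) • rankOne ℂ v v)
      (R - ((t / (1 + t * quadForm R v) : ℝ) : ℂ) • rankOne ℂ (R v) (R v)) := by
  have hq : inner ℂ v (R v) = (quadForm R v : ℂ) := by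
    apply Complex.ext
    · rfl
    · rw [Complex.ofReal_im]
      have h1 := inner_conj_symm (𝕜 := ℂ) v (R v)
      rw [h.symm.pos.inner_comm] at h1
      exact Complex.conj_eq_iff_im.1 h1
  have hne : (1 + (t : ℂ) * quadForm R v) ≠ 0 := by exact_mod_cast ht.ne'
  set c : ℂ := ((t / (1 + t * quadForm R v) : ℝ) : ℂ) with hc_def
  have hc : c * (1 + t * quadForm R v) = t := by
    rw [hc_def]; push_cast; field_simp
  have hR : ∀ x, inner ℂ (R v) x = inner ℂ v (R x) := fun x => h.symm.pos.inner_comm v x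
  refine ⟨isPositive_of_inner_comm (fun x y => ?_) fun x => ?_, fun x => ?_, fun x => ?_⟩
  · simp only [FunLike.coe_add, Pi.add_apply, FunLike.coe_smul, Pi.smul_apply,
      InnerProductSpace.rankOne_apply, inner_add_left, inner_add_right, inner_smul_left,
      inner_smul_right, h.pos.inner_comm, Complex.conj_ofReal, inner_conj_symm]
    ring
  · rw [quadForm_add, quadForm_smul, quadForm_rankOne]
    have h1 := h.norm_inner_sq_le v x
    have h2 := h.pos.quadForm_nonneg x
    -- For `t ≤ 0`, `h1` bounds the new form below by `(1 + t ⟪v, R v⟫) ⟪x, P x⟫`.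
    rcases le_total 0 t with h0 | h0
    · positivity
    · nlinarith [mul_le_mul_of_nonpos_left h1 h0, mul_nonneg ht.le h2]
  · simp only [FunLike.coe_add, Pi.add_apply, FunLike.coe_smul, Pi.smul_apply, FunLike.coe_sub,
      Pi.sub_apply, InnerProductSpace.rankOne_apply, map_sub, map_smul, h.apply_inv, hR, hq]
    linear_combination (norm := module) (-inner ℂ v (R x) * hc) • v
  · simp only [FunLike.coe_add, Pi.add_apply, FunLike.coe_smul, Pi.smul_apply, FunLike.coe_sub,
      Pi.sub_apply, InnerProductSpace.rankOne_apply, map_add, map_smul, h.inv_apply, hR, hq]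
    linear_combination (norm := module) (-inner ℂ v x * hc) • R v

end IsPosInverse

end PositiveOperators

/-! ### Greedy choice of points by averaging -/

section Sampling

variable {D : Type*} [MeasurableSpace D]

/-- A family of admissible lists of weighted points that contains the empty list, and in which each
list of length `< n` can be extended by any weight `z⁻¹` with `z` above a nonnegative function of
integral at most one. -/
structure IsUpperStrategy (μ : Measure D) (n : ℕ) (S : List (D × ℝ) → Prop) : Prop where
  nil : S []
  step : ∀ l, l.length < n → S l → ∃ U : D → ℝ, Integrable U μ ∧ (∀ x, 0 ≤ U x) ∧
    ∫ x, U x ∂μ ≤ 1 ∧ ∀ᵐ x ∂μ, ∀ z > 0, U x ≤ z → S ((x, z⁻¹) :: l)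

/-- A family of admissible lists of weighted points that contains the empty list, and in which each
list of length `< n` can be extended by any weight `z⁻¹` with `z` below a function of integral at
least one. -/
structure IsLowerStrategy (μ : Measure D) (n : ℕ) (S : List (D × ℝ) → Prop) : Prop where
  nil : S []
  step : ∀ l, l.length < n → S l → ∃ L : D → ℝ, Integrable L μ ∧
    1 ≤ ∫ x, L x ∂μ ∧ ∀ᵐ x ∂μ, ∀ z > 0, z ≤ L x → S ((x, z⁻¹) :: l)

/-- If no such point existed, `L ≤ 0 ≤ U` would hold wherever `U ≤ L`, so `U - L ≥ 0` a.e. with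
integral at most zero. Then `U = L` a.e., hence `L ≤ 0` a.e., against `∫ L > 0`. -/
lemma exists_le_and_pos_of_integral {μ : Measure D} {U L : D → ℝ} (hU : Integrable U μ)
    (hL : Integrable L μ) (hU0 : ∀ x, 0 ≤ U x) (hUL : ∫ x, U x ∂μ ≤ ∫ x, L x ∂μ)
    (hL0 : 0 < ∫ x, L x ∂μ) {G : D → Prop} (hG : ∀ᵐ x ∂μ, G x) :
    ∃ x, G x ∧ U x ≤ L x ∧ 0 < L x := by
  by_contra! h
  have h1 : ∀ᵐ x ∂μ, 0 ≤ (U - L) x := by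
    filter_upwards [hG] with x hx
    rw [Pi.sub_apply, sub_nonneg]
    by_cases hle : U x ≤ L x
    · exact (h x hx hle).trans (hU0 x)
    · exact (not_le.1 hle).le
  have h2 : ∫ x, (U - L) x ∂μ = 0 := by
    refine le_antisymm ?_ (integral_nonneg_of_ae h1)
    simp only [Pi.sub_apply]
    rw [integral_sub hU hL]
    linarith
  have h3 := (integral_eq_zero_iff_of_nonneg_ae h1 (hU.sub hL)).1 h2
  have h4 : ∀ᵐ x ∂μ, L x ≤ 0 := by
    filter_upwards [hG, h3] with x hx hx3
    exact h x hx (by simpa [sub_eq_zero] using hx3.le)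
  exact absurd (integral_nonpos_of_ae h4) (not_le.2 hL0)

/-- Two strategies can be followed simultaneously. -/
theorem exists_list_of_strategies {μ : Measure D} {n : ℕ} {S T : List (D × ℝ) → Prop}
    (hS : IsUpperStrategy μ n S) (hT : IsLowerStrategy μ n T) {G : D → Prop}
    (hG : ∀ᵐ x ∂μ, G x) :
    ∃ l : List (D × ℝ), l.length = n ∧ S l ∧ T l ∧ ∀ p ∈ l, G p.1 ∧ 0 < p.2 := by
  suffices h : ∀ k ≤ n, ∃ l : List (D × ℝ), l.length = k ∧ S l ∧ T l ∧ ∀ p ∈ l, G p.1 ∧ 0 < p.2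
    from h n le_rfl
  intro k
  induction k with
  | zero => exact fun _ => ⟨[], rfl, hS.nil, hT.nil, by simp⟩
  | succ k ih =>
    intro hk
    obtain ⟨l, hl, hSl, hTl, hp⟩ := ih (by omega)
    obtain ⟨U, hU, hU0, hU1, hUS⟩ := hS.step l (by omega) hSl
    obtain ⟨L, hL, hL1, hLT⟩ := hT.step l (by omega) hTl
    obtain ⟨x, ⟨hx1, hx2, hx3⟩, hUL, hL0⟩ := exists_le_and_pos_of_integral hU hL hU0
      (hU1.trans hL1) (by linarith) (hG.and (hUS.and hLT))
    refine ⟨(x, (L x)⁻¹) :: l, by simp [hl], hx2 _ hL0 hUL, hx3 _ hL0 le_rfl, ?_⟩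
    intro p hpm
    rcases List.mem_cons.1 hpm with rfl | hpm
    · exact ⟨hx1, inv_pos.2 hL0⟩
    · exact hp p hpm

end Sampling

/-! ### Potentials and second moments -/

section QuadIntegral

variable {D : Type*} [MeasurableSpace D] {μ : Measure D}
variable {E : Type*} [NormedAddCommGroup E] [InnerProductSpace ℂ E]

lemma integrable_quadForm {v : D → E} (hv : MemLp v 2 μ) (A : E →L[ℂ] E) :
    Integrable (fun x => quadForm A (v x)) μ := by
  have h2 : Integrable (fun x => ‖A‖ * ‖v x‖ ^ 2) μ :=
    (hv.integrable_norm_pow (by norm_num)).const_mul _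
  refine h2.mono' ?_ (ae_of_all _ fun x => ?_)
  · exact Complex.continuous_re.comp_aestronglyMeasurable
      (hv.1.inner (A.continuous.comp_aestronglyMeasurable hv.1))
  · calc ‖quadForm A (v x)‖ ≤ ‖inner ℂ (v x) (A (v x))‖ := Complex.abs_re_le_norm _
      _ ≤ ‖v x‖ * ‖A (v x)‖ := norm_inner_le_norm _ _
      _ ≤ ‖v x‖ * (‖A‖ * ‖v x‖) := by gcongr; exact A.le_opNorm _
      _ = _ := by ring

lemma memLp_clm_apply {v : D → E} (hv : MemLp v 2 μ) (A : E →L[ℂ] E) :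
    MemLp (fun x => A (v x)) 2 μ := A.comp_memLp' hv

lemma integrable_norm_inner_sq {v : D → E} (hv : MemLp v 2 μ) (g : E) :
    Integrable (fun x => ‖inner ℂ (v x) g‖ ^ 2) μ :=
  (hv.inner_const g).integrable_norm_pow (by norm_num)

/-- If `∫ ⟪v, P⁻¹ v⟫ ≤ ε`, then `∫ v vᴴ ≤ ε P`. -/
lemma IsPosInverse.integral_norm_inner_sq_le {P R : E →L[ℂ] E} (h : IsPosInverse P R) {v : D → E}
    (hv : MemLp v 2 μ) {ε : ℝ} (hε : ∫ x, quadForm R (v x) ∂μ ≤ ε) (g : E) :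
    ∫ x, ‖inner ℂ (v x) g‖ ^ 2 ∂μ ≤ ε * quadForm P g := by
  calc ∫ x, ‖inner ℂ (v x) g‖ ^ 2 ∂μ ≤ ∫ x, quadForm R (v x) * quadForm P g ∂μ :=
        integral_mono (integrable_norm_inner_sq hv g) ((integrable_quadForm hv R).mul_const _)
          fun x => h.norm_inner_sq_le _ _
    _ = (∫ x, quadForm R (v x) ∂μ) * quadForm P g := integral_mul_const _ _
    _ ≤ _ := mul_le_mul_of_nonneg_right hε (h.pos.quadForm_nonneg g)

lemma integral_quadForm_sub_rankOne {v : D → E} (hv : MemLp v 2 μ) (R : E →L[ℂ] E) (c : ℝ)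
    (u : E) : ∫ x, quadForm (R - (c : ℂ) • rankOne ℂ u u) (v x) ∂μ =
      ∫ x, quadForm R (v x) ∂μ - c * ∫ x, ‖inner ℂ (v x) u‖ ^ 2 ∂μ := by
  simp only [quadForm_sub, quadForm_smul, quadForm_rankOne, norm_inner_symm u]
  rw [integral_sub (integrable_quadForm hv R) ((integrable_norm_inner_sq hv u).const_mul c),
    integral_const_mul]

variable (μ) in
/-- The operator `∫ v vᴴ dμ`. -/
noncomputable def secondMoment (v : D → E) : E →L[ℂ] E := ∫ x, rankOne ℂ (v x) (v x) ∂μ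

lemma integrable_rankOne {v : D → E} (hv : MemLp v 2 μ) :
    Integrable (fun x => rankOne ℂ (v x) (v x)) μ := by
  refine (hv.integrable_norm_pow (p := 2) (by norm_num)).mono' ?_ (ae_of_all _ fun x => ?_)
  · have : Continuous fun u : E => rankOne ℂ u u := by
      simp only [InnerProductSpace.rankOne_def]
      fun_prop
    exact this.comp_aestronglyMeasurable hv.1
  · simp [sq]

variable [CompleteSpace E]

lemma inner_secondMoment {v : D → E} (hv : MemLp v 2 μ) (g h : E) :
    inner ℂ g (secondMoment μ v h) = ∫ x, inner ℂ g (v x) * inner ℂ (v x) h ∂μ := by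
  have h1 : secondMoment μ v h = ∫ x, rankOne ℂ (v x) (v x) h ∂μ :=
    ContinuousLinearMap.integral_apply (integrable_rankOne hv) h
  rw [h1, ← integral_inner ((integrable_rankOne hv).apply_continuousLinearMap h)]
  simp only [InnerProductSpace.rankOne_apply, inner_smul_right, mul_comm]

lemma quadForm_secondMoment {v : D → E} (hv : MemLp v 2 μ) (g : E) :
    quadForm (secondMoment μ v) g = ∫ x, ‖inner ℂ (v x) g‖ ^ 2 ∂μ := by
  have : ∀ x, inner ℂ g (v x) * inner ℂ (v x) g = ((‖inner ℂ (v x) g‖ ^ 2 : ℝ) : ℂ) := fun x => by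
    rw [← inner_conj_symm g, mul_comm, Complex.mul_conj, Complex.normSq_eq_norm_sq]
  rw [quadForm, inner_secondMoment hv]
  simp only [this]
  rw [integral_complex_ofReal, Complex.ofReal_re]

lemma secondMoment_isPositive {v : D → E} (hv : MemLp v 2 μ) : (secondMoment μ v).IsPositive := by
  refine isPositive_of_inner_comm (fun x y => ?_) fun x => ?_
  · rw [← inner_conj_symm, inner_secondMoment hv, inner_secondMoment hv, ← integral_conj]
    simp only [map_mul, inner_conj_symm, mul_comm]
  · rw [quadForm_secondMoment hv]
    positivity

end QuadIntegral

/-! ### Trace strategies and the upper barrier -/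

section Strategies

variable {D : Type*} [MeasurableSpace D] {μ : Measure D}
variable {E : Type*} [NormedAddCommGroup E] [InnerProductSpace ℂ E]

/-- The frame operator `∑ w • v(x) v(x)ᴴ` of a list of weighted points. -/
noncomputable def frameOp (v : D → E) (l : List (D × ℝ)) : E →L[ℂ] E :=
  (l.map fun p => (p.2 : ℂ) • rankOne ℂ (v p.1) (v p.1)).sum

omit [MeasurableSpace D] in
lemma frameOp_nil (v : D → E) : frameOp v [] = 0 := rfl

omit [MeasurableSpace D] in
lemma frameOp_cons (v : D → E) (x : D) (w : ℝ) (l : List (D × ℝ)) :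
    frameOp v ((x, w) :: l) = (w : ℂ) • rankOne ℂ (v x) (v x) + frameOp v l := by
  simp [frameOp]

omit [MeasurableSpace D] in
lemma quadForm_frameOp (v : D → E) (l : List (D × ℝ)) (g : E) :
    quadForm (frameOp v l) g = (l.map fun p => p.2 * ‖inner ℂ (v p.1) g‖ ^ 2).sum := by
  induction l with
  | nil => simp [frameOp, quadForm]
  | cons p l ih =>
    obtain ⟨x, w⟩ := p
    rw [frameOp_cons, quadForm_add, quadForm_smul, quadForm_rankOne, ih]
    simp

lemma not_ae_eq_zero_of_integral_pos {v : D → E} {g : E}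
    (h : 0 < ∫ x, ‖inner ℂ (v x) g‖ ^ 2 ∂μ) : ¬ ∀ᵐ x ∂μ, v x = 0 := by
  intro h0
  refine h.ne' (integral_eq_zero_of_ae ?_)
  filter_upwards [h0] with x hx
  simp [hx]

omit [InnerProductSpace ℂ E] in
lemma integral_pos_of_not_ae_eq_zero {v : D → E} {q : D → ℝ} (hq : Integrable q μ)
    (hq0 : ∀ x, 0 ≤ q x) (hqv : ∀ x, q x = 0 → v x = 0) (hv : ¬ ∀ᵐ x ∂μ, v x = 0) :
    0 < ∫ x, q x ∂μ := by
  refine lt_of_le_of_ne (integral_nonneg hq0) fun h => hv ?_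
  filter_upwards [(integral_eq_zero_iff_of_nonneg hq0 hq).1 h.symm] with x hx
  exact hqv x hx

omit [InnerProductSpace ℂ E] in
/-- Choosing the weights such that the trace of the frame operator stays small. -/
theorem trace_isUpperStrategy {v : D → E} (hv : MemLp v 2 μ) (hv0 : ¬ ∀ᵐ x ∂μ, v x = 0) (n : ℕ) :
    IsUpperStrategy μ n fun l =>
      (l.map fun p => p.2 * ‖v p.1‖ ^ 2).sum ≤ (∫ x, ‖v x‖ ^ 2 ∂μ) * l.length := by
  have hi : Integrable (fun x => ‖v x‖ ^ 2) μ := hv.integrable_norm_pow (by norm_num)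
  have hM : 0 < ∫ x, ‖v x‖ ^ 2 ∂μ :=
    integral_pos_of_not_ae_eq_zero hi (fun x => by positivity) (fun x hx => by simpa using hx) hv0
  refine ⟨by simp, fun l _ hl => ⟨fun x => ‖v x‖ ^ 2 / ∫ x, ‖v x‖ ^ 2 ∂μ, hi.div_const _,
    fun x => by positivity, ?_, ae_of_all _ fun x z hz hxz => ?_⟩⟩
  · rw [integral_div, div_self hM.ne']
  · simp only [List.map_cons, List.sum_cons, List.length_cons]
    rw [div_le_iff₀ hM, ← inv_mul_le_iff₀ hz] at hxz
    push_cast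
    linarith

omit [InnerProductSpace ℂ E] in
/-- In dimension one, each weight can be chosen such that its point contributes at least one. -/
theorem norm_sq_isLowerStrategy {v : D → E} (hv : MemLp v 2 μ) (hM : 1 ≤ ∫ x, ‖v x‖ ^ 2 ∂μ)
    (n : ℕ) : IsLowerStrategy μ n fun l => (l.length : ℝ) ≤ (l.map fun p => p.2 * ‖v p.1‖ ^ 2).sum := by
  refine ⟨by simp, fun l _ hl => ⟨fun x => ‖v x‖ ^ 2, hv.integrable_norm_pow (by norm_num), hM,
    ae_of_all _ fun x z hz hxz => ?_⟩⟩
  simp only [List.map_cons, List.sum_cons, List.length_cons]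
  have : 1 ≤ z⁻¹ * ‖v x‖ ^ 2 := by rwa [le_inv_mul_iff₀ hz, mul_one]
  push_cast
  linarith

variable [CompleteSpace E]

lemma IsPosInverse.exists_add {P R T : E →L[ℂ] E} (h : IsPosInverse P R) (hT : T.IsPositive)
    {δ : ℝ} (hδ : 0 ≤ δ) : ∃ R', IsPosInverse (P + (δ : ℂ) • T) R' := by
  obtain ⟨c, hc, hcP⟩ := h.coercive
  refine IsPosInverse.exists_of_coercive (h.pos.add (hT.smul_of_nonneg ?_)) hc fun x => ?_
  · exact_mod_cast hδ
  · rw [quadForm_add, quadForm_smul]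
    have := mul_nonneg hδ (hT.quadForm_nonneg x)
    linarith [hcP x]

omit [CompleteSpace E] in
/-- The resolvent identity `P⁻¹ = (P + δ T)⁻¹ + δ (P + δ T)⁻¹ T P⁻¹`, applied twice. -/
lemma IsPosInverse.quadForm_add_le {P R T R' : E →L[ℂ] E} (h : IsPosInverse P R)
    {δ : ℝ} (h' : IsPosInverse (P + (δ : ℂ) • T) R') (hT : T.IsPositive) (x : E) :
    quadForm R' x + δ * quadForm T (R' x) ≤ quadForm R x := by
  have key : ∀ y, R y = R' y + (δ : ℂ) • R' (T (R y)) := fun y => by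
    have := h'.inv_apply (R y)
    rw [FunLike.coe_add, Pi.add_apply, h.apply_inv, map_add, FunLike.coe_smul, Pi.smul_apply,
      map_smul] at this
    exact this.symm
  have key' : ∀ y, R y = R' y + (δ : ℂ) • R (T (R' y)) := fun y => by
    have h1 := h.inv_apply (R' y)
    have h2 := h'.apply_inv y
    rw [FunLike.coe_add, Pi.add_apply, FunLike.coe_smul, Pi.smul_apply] at h2
    conv_lhs => rw [← h2, map_add, map_smul, h1]
  -- As operators, `R = R' + δ R' T R' + δ² R' T R T R'`; the last term is positive and is dropped.
  have e : quadForm R x = quadForm R' x + δ * quadForm T (R' x) +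
      δ ^ 2 * quadForm R (T (R' x)) := by
    have e1 : inner ℂ x (R x) = inner ℂ x (R' x) + δ * inner ℂ (R' x) (T (R' x)) +
        δ ^ 2 * inner ℂ (T (R' x)) (R (T (R' x))) := by
      conv_lhs => rw [key x]
      rw [key' x]
      have e2 : inner ℂ x (R' (T (R' x))) = inner ℂ (R' x) (T (R' x)) :=
        (h'.symm.pos.inner_comm _ _).symm
      have e3 : inner ℂ x (R' (T (R (T (R' x))))) = inner ℂ (T (R' x)) (R (T (R' x))) := by
        rw [← h'.symm.pos.inner_comm, ← hT.inner_comm]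
      simp only [map_add, map_smul, inner_add_right, inner_smul_right, e2, e3]
      ring
    rw [quadForm, e1]
    simp [quadForm, ← Complex.ofReal_pow]
  rw [e]
  have := h.symm.pos.quadForm_nonneg (T (R' x))
  have : 0 ≤ δ ^ 2 * quadForm R (T (R' x)) := by positivity
  linarith

/-- The barrier operator at a list of weighted points. -/
noncomputable def upperBarrier (μ : Measure D) (v : D → E) (c β δ : ℝ) (l : List (D × ℝ)) :
    E →L[ℂ] E :=
  (c : ℂ) • 1 + ((β + l.length * δ : ℝ) : ℂ) • secondMoment μ v - frameOp v l

/-- Choosing the weights such that the barrier operator stays positive with bounded potential. -/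
theorem barrier_isUpperStrategy {v : D → E} (hv : MemLp v 2 μ) (hv0 : ¬ ∀ᵐ x ∂μ, v x = 0)
    (hinj : ∀ g : E, g ≠ 0 → 0 < ∫ x, ‖inner ℂ (v x) g‖ ^ 2 ∂μ) {c β δ ε : ℝ} (hδ : 0 < δ)
    (hδε : ε + 1 / δ = 1)
    (h0 : ∃ R, IsPosInverse (upperBarrier μ v c β δ []) R ∧ ∫ x, quadForm R (v x) ∂μ ≤ ε) (n : ℕ) :
    IsUpperStrategy μ n fun l =>
      ∃ R, IsPosInverse (upperBarrier μ v c β δ l) R ∧ ∫ x, quadForm R (v x) ∂μ ≤ ε := by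
  refine ⟨h0, fun l _ ⟨R, hR, hRε⟩ => ?_⟩
  set T := secondMoment μ v with hT_def
  have hT : T.IsPositive := secondMoment_isPositive hv
  obtain ⟨R', hR'⟩ := hR.exists_add hT hδ.le
  have hp := integrable_quadForm hv R'
  have hq := integrable_quadForm (memLp_clm_apply hv R') T
  have hp0 : ∀ x, 0 ≤ quadForm R' (v x) := fun x => hR'.symm.pos.quadForm_nonneg _
  have hq0 : ∀ x, 0 ≤ quadForm T (R' (v x)) := fun x => hT.quadForm_nonneg _
  have hq1 : ∀ x, quadForm T (R' (v x)) = 0 → v x = 0 := fun x hx => by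
    by_contra hne
    have h1 : R' (v x) ≠ 0 := fun h1 => hne (by rw [← hR'.apply_inv (v x), h1, map_zero])
    have h2 := hinj _ h1
    rw [← quadForm_secondMoment hv, hx] at h2
    exact lt_irrefl _ h2
  set Q := ∫ x, quadForm T (R' (v x)) ∂μ with hQ_def
  have hQ : 0 < Q := integral_pos_of_not_ae_eq_zero hq hq0 hq1 hv0
  -- Advancing the barrier by `δ T` lowers the potential by at least `δ Q`; the new point may use up
  -- exactly this gain.
  have hmono : ∫ x, quadForm R' (v x) ∂μ + δ * Q ≤ ε := by
    rw [hQ_def, ← integral_const_mul, ← integral_add hp (hq.const_mul δ)]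
    exact (integral_mono (hp.add (hq.const_mul δ)) (integrable_quadForm hv R)
      fun x => hR.quadForm_add_le hR' hT (v x)).trans hRε
  -- With `p = ⟪v, R' v⟫` and `q = ⟪R' v, T R' v⟫`, the point raises the potential by `q / (z - p)`.
  -- This is at most `δ Q` once `z ≥ p + q / (δ Q)`, whose integral is at most `ε - δ Q + 1/δ ≤ 1`.
  refine ⟨fun x => quadForm R' (v x) + quadForm T (R' (v x)) / (δ * Q),
    hp.add (hq.div_const _), fun x => add_nonneg (hp0 x) (div_nonneg (hq0 x) (by positivity)), ?_,
    ae_of_all _ fun x z hz hxz => ?_⟩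
  · rw [integral_add hp (hq.div_const _), integral_div, ← hQ_def]
    have : Q / (δ * Q) = 1 / δ := by field_simp
    rw [this]
    nlinarith [mul_pos hδ hQ]
  · have hpz : quadForm R' (v x) < z := by
      rcases eq_or_ne (v x) 0 with h | h
      · simpa [h, quadForm] using hz
      · have h1 : 0 < quadForm T (R' (v x)) := lt_of_le_of_ne (hq0 x) fun h2 => h (hq1 x h2.symm)
        have h2 : 0 < quadForm T (R' (v x)) / (δ * Q) := by positivity
        linarith
    have hzp : 0 < z - quadForm R' (v x) := sub_pos.2 hpz
    have ht : 0 < 1 + (-z⁻¹) * quadForm R' (v x) := by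
      have : 1 + (-z⁻¹) * quadForm R' (v x) = (z - quadForm R' (v x)) / z := by
        field_simp
        ring
      rw [this]
      positivity
    have hnew := hR'.add_rankOne (v x) (-z⁻¹) ht
    refine ⟨R' - ((-z⁻¹ / (1 + -z⁻¹ * quadForm R' (v x)) : ℝ) : ℂ) •
      rankOne ℂ (R' (v x)) (R' (v x)), ?_, ?_⟩
    · convert hnew using 1
      rw [upperBarrier, upperBarrier, frameOp_cons, List.length_cons]
      push_cast
      module
    · rw [integral_quadForm_sub_rankOne hv, ← quadForm_secondMoment hv, ← hT_def]
      have e : -z⁻¹ / (1 + -z⁻¹ * quadForm R' (v x)) = - (1 / (z - quadForm R' (v x))) := by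
        have : (1 + -z⁻¹ * quadForm R' (v x)) = (z - quadForm R' (v x)) / z := by
          field_simp
          ring
        rw [this]
        field_simp
      have h3 : quadForm T (R' (v x)) / (z - quadForm R' (v x)) ≤ δ * Q := by
        rw [div_le_iff₀ hzp, ← div_le_iff₀' (by positivity)]
        linarith
      rw [e, neg_mul, sub_neg_eq_add, one_div_mul_eq_div]
      linarith

end Strategies

/-! ### The lower barrier -/

section LowerBarrier

variable {D : Type*} [MeasurableSpace D] {μ : Measure D}
variable {E : Type*} [NormedAddCommGroup E] [InnerProductSpace ℂ E]

/-- Combine `κ ‖R x‖² ≤ ⟪x, R x⟫ ≤ ‖x‖ ‖R x‖` with the square of `κ ‖R x‖ - ‖x‖`. -/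
lemma IsPosInverse.quadForm_inv_le {P R : E →L[ℂ] E} (h : IsPosInverse P R) {κ : ℝ} (hκ : 0 < κ)
    (hP : ∀ x, κ * ‖x‖ ^ 2 ≤ quadForm P x) (x : E) : quadForm R x ≤ ‖x‖ ^ 2 / κ := by
  have h1 := hP (R x)
  rw [quadForm, h.apply_inv] at h1
  have h2 : quadForm R x ≤ ‖x‖ * ‖R x‖ := (Complex.re_le_norm _).trans (norm_inner_le_norm _ _)
  have h3 : (inner ℂ (R x) x).re = quadForm R x := by rw [quadForm, h.symm.pos.inner_comm]
  rw [h3] at h1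
  rw [le_div_iff₀ hκ]
  nlinarith [sq_nonneg (κ * ‖R x‖ - ‖x‖)]

/-- The relations between the forms of `(P - δ)⁻¹` and `P⁻¹` that control the lower barrier. -/
lemma IsPosInverse.resolvent_relations {P R R' : E →L[ℂ] E} (h : IsPosInverse P R) {δ : ℝ}
    (h' : IsPosInverse (P - (δ : ℂ) • 1) R') (x : E) :
    quadForm R' x - quadForm R x = δ * (inner ℂ x (R (R' x))).re ∧
    ‖R' x‖ ^ 2 - (inner ℂ x (R (R' x))).re = δ * quadForm R (R' x) ∧
    (inner ℂ x (R (R' x))).re ^ 2 ≤ quadForm R x * quadForm R (R' x) ∧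
    (inner ℂ x (R (R' x))).re = ‖R x‖ ^ 2 + δ * quadForm R' (R x) := by
  have k1 : R' x = R x + (δ : ℂ) • R (R' x) := by
    have h1 := congrArg R (h'.apply_inv x)
    simp only [FunLike.coe_sub, Pi.sub_apply, FunLike.coe_smul, Pi.smul_apply,
      one_apply_eq_self, map_sub, map_smul, h.inv_apply] at h1
    rw [← h1]
    abel
  have k2 : R' x = R x + (δ : ℂ) • R' (R x) := by
    have h1 := h'.inv_apply (R x)
    simp only [FunLike.coe_sub, Pi.sub_apply, FunLike.coe_smul, Pi.smul_apply,
      one_apply_eq_self, map_sub, map_smul, h.apply_inv] at h1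
    rw [sub_eq_iff_eq_add] at h1
    exact h1
  have k3 : (inner ℂ x (R (R' x))).re = (inner ℂ (R' x) (R x)).re := by
    rw [← h.symm.pos.inner_comm]
    exact inner_re_symm (𝕜 := ℂ) _ _
  have hn : ∀ y : E, (inner ℂ y y).re = ‖y‖ ^ 2 := fun y => inner_self_eq_norm_sq (𝕜 := ℂ) y
  refine ⟨?_, ?_, ?_, ?_⟩
  · have : inner ℂ x (R' x) = inner ℂ x (R x) + δ * inner ℂ x (R (R' x)) := by
      conv_lhs => rw [k1]
      rw [inner_add_right, inner_smul_right]
    rw [quadForm, this]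
    simp [quadForm]
  · have : inner ℂ (R' x) (R' x) = inner ℂ (R' x) (R x) + δ * inner ℂ (R' x) (R (R' x)) := by
      have h1 := congrArg (inner ℂ (R' x)) k1
      rwa [inner_add_right, inner_smul_right] at h1
    rw [k3, ← hn, this]
    simp [quadForm]
  · refine le_trans ?_ (h.symm.pos.norm_inner_sq_le x (R' x))
    exact sq_le_sq' (neg_le_of_abs_le (Complex.abs_re_le_norm _)) (Complex.re_le_norm _)
  · have : inner ℂ (R' x) (R x) = inner ℂ (R x) (R x) + δ * inner ℂ (R x) (R' (R x)) := by
      conv_lhs => rw [k2]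
      rw [inner_add_left, inner_smul_left, h'.symm.pos.inner_comm, Complex.conj_ofReal]
    rw [k3, this, Complex.add_re, hn]
    simp [quadForm]

/-- The shifted frame operator at a list of weighted points. -/
noncomputable def lowerBarrier (v : D → E) (c δ : ℝ) (l : List (D × ℝ)) : E →L[ℂ] E :=
  frameOp v l + ((c - l.length * δ : ℝ) : ℂ) • 1

variable [CompleteSpace E]

/-- Choosing the weights such that the shifted frame operator stays positive with bounded
potential. -/
theorem barrier_isLowerStrategy {v : D → E} (hv : MemLp v 2 μ) (hv0 : ¬ ∀ᵐ x ∂μ, v x = 0)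
    (hiso : ∀ g : E, ∫ x, ‖inner ℂ (v x) g‖ ^ 2 ∂μ = ‖g‖ ^ 2) {c δ ε : ℝ} (hδ : 0 < δ) (hε : 0 < ε)
    (hδε : 1 / δ - ε = 1)
    (h0 : ∃ R, IsPosInverse (lowerBarrier v c δ []) R ∧ ∫ x, quadForm R (v x) ∂μ ≤ ε) (n : ℕ) :
    IsLowerStrategy μ n fun l =>
      ∃ R, IsPosInverse (lowerBarrier v c δ l) R ∧ ∫ x, quadForm R (v x) ∂μ ≤ ε := by
  refine ⟨h0, fun l _ ⟨R, hR, hRε⟩ => ?_⟩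
  set P := lowerBarrier v c δ l with hP
  have hδε' : δ * ε < 1 := by
    have : δ * (1 / δ - ε) = δ := by rw [hδε, mul_one]
    rw [mul_sub, mul_one_div_cancel hδ.ne'] at this
    linarith
  have hκ : 0 < 1 / ε - δ := by
    rw [sub_pos, lt_div_iff₀ hε]
    exact hδε'
  -- The potential bound says `1 ≤ ε P`, so the shift by `δ < 1/ε` leaves a positive invertible
  -- operator.
  have hcoer : ∀ g, (1 / ε - δ) * ‖g‖ ^ 2 ≤ quadForm (P - (δ : ℂ) • 1) g := fun g => by
    have h1 := hR.integral_norm_inner_sq_le hv hRε g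
    rw [hiso, ← div_le_iff₀' hε] at h1
    rw [quadForm_sub, quadForm_smul, quadForm_one]
    have : (1 / ε - δ) * ‖g‖ ^ 2 = ‖g‖ ^ 2 / ε - δ * ‖g‖ ^ 2 := by ring
    linarith
  have hpos : (P - (δ : ℂ) • 1).IsPositive := by
    refine isPositive_of_inner_comm (fun x y => ?_) fun x => le_trans (by positivity) (hcoer x)
    simp [hR.pos.inner_comm]
  obtain ⟨R', hR'⟩ := IsPosInverse.exists_of_coercive hpos hκ hcoer
  have hrel := fun x => hR.resolvent_relations hR' (v x)
  have hφ := integrable_quadForm hv R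
  have hp := integrable_quadForm hv R'
  have hp0 : ∀ x, 0 ≤ quadForm R' (v x) := fun x => hR'.symm.pos.quadForm_nonneg _
  have hq : Integrable (fun x => ‖R' (v x)‖ ^ 2) μ :=
    (memLp_clm_apply hv R').integrable_norm_pow (by norm_num)
  have hξ : Integrable (fun x => (inner ℂ (v x) (R (R' (v x)))).re) μ :=
    integrable_quadForm hv (R ∘L R')
  have hy := integrable_quadForm (memLp_clm_apply hv R') R
  have hy0 : ∀ x, 0 ≤ quadForm R (R' (v x)) := fun x => hR.symm.pos.quadForm_nonneg _
  have hξ1 : ∀ x, ‖R (v x)‖ ^ 2 ≤ (inner ℂ (v x) (R (R' (v x)))).re := fun x => by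
    rw [(hrel x).2.2.2]
    have := mul_nonneg hδ.le (hR'.symm.pos.quadForm_nonneg (R (v x)))
    linarith
  set X := ∫ x, (inner ℂ (v x) (R (R' (v x)))).re ∂μ with hX_def
  set Y := ∫ x, quadForm R (R' (v x)) ∂μ with hY_def
  set Q := ∫ x, ‖R' (v x)‖ ^ 2 ∂μ with hQ_def
  have hX : 0 < X := by
    refine integral_pos_of_not_ae_eq_zero hξ (fun x => le_trans (by positivity) (hξ1 x))
      (fun x hx => ?_) hv0
    have h1 := hξ1 x
    rw [hx] at h1
    have h2 : R (v x) = 0 := by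
      rw [← norm_eq_zero]
      exact pow_eq_zero_iff (two_ne_zero) |>.1 (le_antisymm h1 (by positivity))
    rw [← hR.apply_inv (v x), h2, map_zero]
  have hΔ : ∫ x, quadForm R' (v x) ∂μ = ∫ x, quadForm R (v x) ∂μ + δ * X := by
    rw [hX_def, ← integral_const_mul, ← integral_add hφ (hξ.const_mul δ)]
    exact integral_congr_ae (ae_of_all _ fun x => by have := (hrel x).1; dsimp only; linarith)
  have hQ : Q = X + δ * Y := by
    rw [hX_def, hY_def, ← integral_const_mul, ← integral_add hξ (hy.const_mul δ)]
    exact integral_congr_ae (ae_of_all _ fun x => by have := (hrel x).2.1; dsimp only; linarith)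
  -- Cauchy–Schwarz gives `X² ≤ (∫ ⟪v, R v⟫) Y ≤ ε Y`, and `ε < 1/δ`. It is carried out pointwise as
  -- `2 (δ X) ξ ≤ (δ X)² φ + y`, then integrated.
  have hXY : δ * X ^ 2 ≤ Y := by
    have ht : 0 < δ * X := mul_pos hδ hX
    have h1 : X * (2 * (δ * X)) ≤ ∫ x, ((δ * X) ^ 2 * quadForm R (v x) + quadForm R (R' (v x))) ∂μ := by
      rw [hX_def, ← integral_mul_const]
      refine integral_mono (hξ.mul_const _) ((hφ.const_mul _).add hy) fun x => ?_
      rw [← hX_def]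
      dsimp only
      have h2 := (hrel x).2.2.1
      have h3 := hR.symm.pos.quadForm_nonneg (v x)
      refine abs_le_of_sq_le_sq' ?_ (by have := hy0 x; positivity) |>.2
      nlinarith [sq_nonneg ((δ * X) ^ 2 * quadForm R (v x) - quadForm R (R' (v x))),
        mul_le_mul_of_nonneg_left h2 (sq_nonneg (δ * X))]
    rw [integral_add (hφ.const_mul _) hy, integral_const_mul] at h1
    have h4 : (δ * X) ^ 2 * ∫ x, quadForm R (v x) ∂μ ≤ δ * X ^ 2 := by
      calc (δ * X) ^ 2 * ∫ x, quadForm R (v x) ∂μ ≤ (δ * X) ^ 2 * ε := by gcongr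
        _ = (δ * ε) * (δ * X ^ 2) := by ring
        _ ≤ 1 * (δ * X ^ 2) := by gcongr
        _ = _ := one_mul _
    nlinarith
  -- The shift costs `δ X`, and the point regains `‖R' v‖² / (z + ⟪v, R' v⟫)`; this `L` is the
  -- largest `z` for which the cost is recovered. Its integral is at least `(1/δ + δ X) - (ε + δ X)
  -- = 1`.
  refine ⟨fun x => ‖R' (v x)‖ ^ 2 / (δ * X) - quadForm R' (v x), (hq.div_const _).sub hp, ?_,
    ae_of_all _ fun x z hz hxz => ?_⟩
  · rw [integral_sub (hq.div_const _) hp, integral_div, ← hQ_def, hΔ]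
    have h1 : 1 / δ + δ * X ≤ Q / (δ * X) := by
      rw [le_div_iff₀ (mul_pos hδ hX), hQ]
      have : (1 / δ + δ * X) * (δ * X) = X + δ * (δ * X ^ 2) := by field_simp
      rw [this]
      gcongr
    linarith
  · have hzp : 0 < z + quadForm R' (v x) := add_pos_of_pos_of_nonneg hz (hp0 x)
    have e0 : 1 + z⁻¹ * quadForm R' (v x) = (z + quadForm R' (v x)) / z := by field_simp
    have hnew := hR'.add_rankOne (v x) z⁻¹ (by rw [e0]; positivity)
    refine ⟨R' - ((z⁻¹ / (1 + z⁻¹ * quadForm R' (v x)) : ℝ) : ℂ) •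
      rankOne ℂ (R' (v x)) (R' (v x)), ?_, ?_⟩
    · convert hnew using 1
      rw [hP, lowerBarrier, lowerBarrier, frameOp_cons, List.length_cons]
      push_cast
      module
    · rw [integral_quadForm_sub_rankOne hv, hiso, hΔ]
      have e : z⁻¹ / (1 + z⁻¹ * quadForm R' (v x)) = 1 / (z + quadForm R' (v x)) := by
        rw [e0]
        field_simp
      have h3 : δ * X ≤ ‖R' (v x)‖ ^ 2 / (z + quadForm R' (v x)) := by
        rw [le_div_iff₀ hzp, ← le_div_iff₀' (mul_pos hδ hX)]
        linarith
      rw [e, one_div_mul_eq_div]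
      linarith

end LowerBarrier

/-! ### Choice of the barrier parameters -/

section ExistsStrategies

variable {D : Type*} [MeasurableSpace D] {μ : Measure D}
variable {E : Type*} [NormedAddCommGroup E] [InnerProductSpace ℂ E] [CompleteSpace E]

omit [CompleteSpace E] in
lemma IsPosInverse.integral_quadForm_inv_le {P R : E →L[ℂ] E} (h : IsPosInverse P R) {κ : ℝ}
    (hκ : 0 < κ) (hP : ∀ x, κ * ‖x‖ ^ 2 ≤ quadForm P x) {v : D → E} (hv : MemLp v 2 μ) :
    ∫ x, quadForm R (v x) ∂μ ≤ (∫ x, ‖v x‖ ^ 2 ∂μ) / κ := by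
  rw [← integral_div]
  exact integral_mono (integrable_quadForm hv R)
    ((hv.integrable_norm_pow (p := 2) (by norm_num)).div_const κ) fun x => h.quadForm_inv_le hκ hP _

omit [MeasurableSpace D] [CompleteSpace E] in
lemma sum_map_norm_inner_sq_le (v : D → E) (l : List (D × ℝ)) (hl : ∀ p ∈ l, 0 < p.2) (g : E) :
    (l.map fun p => p.2 * ‖inner ℂ (v p.1) g‖ ^ 2).sum ≤
      (l.map fun p => p.2 * ‖v p.1‖ ^ 2).sum * ‖g‖ ^ 2 := by
  rw [← List.sum_map_mul_right]
  refine List.sum_le_sum fun p hp => ?_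
  rw [mul_assoc, ← mul_pow]
  have := (hl p hp).le
  gcongr
  exact norm_inner_le_norm _ _

/-- If `∫ v vᴴ ≤ 1` is injective with trace `M`, then one can choose `n` weighted points with frame
operator at most `n (1 + √((M - 1) / n))²`. -/
theorem exists_upperStrategy [Nontrivial E] {v : D → E} (hv : MemLp v 2 μ)
    (hinj : ∀ g : E, g ≠ 0 → 0 < ∫ x, ‖inner ℂ (v x) g‖ ^ 2 ∂μ)
    (hle : ∀ g : E, ∫ x, ‖inner ℂ (v x) g‖ ^ 2 ∂μ ≤ ‖g‖ ^ 2) {n : ℕ} (hn : 0 < n) :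
    ∃ S, IsUpperStrategy μ n S ∧ ∀ l : List (D × ℝ), l.length = n → (∀ p ∈ l, 0 < p.2) → S l →
      ∀ g : E, (l.map fun p => p.2 * ‖inner ℂ (v p.1) g‖ ^ 2).sum ≤
        n * (1 + √((∫ x, ‖v x‖ ^ 2 ∂μ - 1) / n)) ^ 2 * ‖g‖ ^ 2 := by
  obtain ⟨g₀, hg₀⟩ := exists_ne (0 : E)
  have hv0 := not_ae_eq_zero_of_integral_pos (hinj g₀ hg₀)
  set M := ∫ x, ‖v x‖ ^ 2 ∂μ with hM
  set r := √((M - 1) / n) with hr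
  have hr0 : 0 ≤ r := Real.sqrt_nonneg _
  have hn' : (0 : ℝ) < n := by exact_mod_cast hn
  -- For `n r < 1` the initial coefficient `β` of `T` below would not be nonpositive, but the trace
  -- alone suffices: `M ≤ 1 + n r² ≤ 1 + r`. This case includes `r = 0`.
  rcases lt_or_ge (n * r) 1 with hnr | hnr
  · refine ⟨_, trace_isUpperStrategy hv hv0 n, fun l hl hpos hS g => ?_⟩
    refine (sum_map_norm_inner_sq_le v l hpos g).trans ?_
    gcongr
    refine hS.trans ?_
    rw [hl, ← hM, mul_comm]
    gcongr
    have h1 : (M - 1) / n ≤ r ^ 2 := by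
      rcases le_total 0 ((M - 1) / n) with h | h
      · rw [hr, Real.sq_sqrt h]
      · exact h.trans (by positivity)
    rw [div_le_iff₀ hn'] at h1
    nlinarith
  · have hr1 : 0 < r := by
      rcases hr0.eq_or_lt with h | h
      · rw [← h] at hnr; norm_num at hnr
      · exact h
    have hrM : n * r ^ 2 = M - 1 := by
      rw [hr, Real.sq_sqrt (Real.sqrt_pos.1 hr1).le]
      field_simp
    set T := secondMoment μ v with hT_def
    have hT : T.IsPositive := secondMoment_isPositive hv
    have hT1 : ∀ g, quadForm T g ≤ ‖g‖ ^ 2 := fun g => by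
      rw [hT_def, quadForm_secondMoment hv]; exact hle g
    have hε : 0 < r / (1 + r) := by positivity
    have hM0 : 0 < M := by have : 0 < n * r ^ 2 := by positivity
                           linarith
    have hβ : (1 + r) / r - n * (1 + r) ≤ 0 := by
      rw [sub_nonpos, div_le_iff₀ hr1]
      nlinarith
    have hP : ∀ g, upperBarrier μ v (n * (1 + r) ^ 2) ((1 + r) / r - n * (1 + r)) (1 + r) [] =
        ((n * (1 + r) ^ 2 : ℝ) : ℂ) • (1 : E →L[ℂ] E) +
          (((1 + r) / r - n * (1 + r) : ℝ) : ℂ) • T ∧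
        M / (r / (1 + r)) * ‖g‖ ^ 2 ≤ quadForm
          (upperBarrier μ v (n * (1 + r) ^ 2) ((1 + r) / r - n * (1 + r)) (1 + r) []) g := fun g => by
      have h1 : upperBarrier μ v (n * (1 + r) ^ 2) ((1 + r) / r - n * (1 + r)) (1 + r) [] =
        ((n * (1 + r) ^ 2 : ℝ) : ℂ) • (1 : E →L[ℂ] E) +
          (((1 + r) / r - n * (1 + r) : ℝ) : ℂ) • T := by
        simp [upperBarrier, frameOp_nil, hT_def]
      refine ⟨h1, ?_⟩
      rw [h1, quadForm_add, quadForm_smul, quadForm_smul, quadForm_one]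
      have h2 := mul_le_mul_of_nonpos_left (hT1 g) hβ
      -- Since `β ≤ 0` and `T ≤ 1`, the initial barrier is at least `c + β = M / ε`, making the
      -- initial potential at most `ε`.
      have h3 : M / (r / (1 + r)) = n * (1 + r) ^ 2 + ((1 + r) / r - n * (1 + r)) := by
        have : M = n * r ^ 2 + 1 := by linarith
        rw [this]
        field_simp
        ring
      rw [h3]
      linarith
    have hPpos : (upperBarrier μ v (n * (1 + r) ^ 2) ((1 + r) / r - n * (1 + r)) (1 + r) [] :
        E →L[ℂ] E).IsPositive := by
      refine isPositive_of_inner_comm (fun x y => ?_) fun x => le_trans (by positivity) (hP x).2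
      rw [(hP 0).1]
      simp only [FunLike.coe_add, Pi.add_apply, FunLike.coe_smul, Pi.smul_apply, inner_add_left,
        inner_add_right, inner_smul_left, inner_smul_right, hT.inner_comm, one_apply_eq_self,
        Complex.conj_ofReal]
    have hκ : 0 < M / (r / (1 + r)) := by positivity
    obtain ⟨R₀, hR₀⟩ := IsPosInverse.exists_of_coercive hPpos hκ fun g => (hP g).2
    have hR₀ε : ∫ x, quadForm R₀ (v x) ∂μ ≤ r / (1 + r) := by
      refine (hR₀.integral_quadForm_inv_le hκ (fun g => (hP g).2) hv).trans_eq ?_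
      rw [← hM]
      field_simp
    refine ⟨_, barrier_isUpperStrategy hv hv0 hinj (c := n * (1 + r) ^ 2)
      (β := (1 + r) / r - n * (1 + r)) (δ := 1 + r) (ε := r / (1 + r)) (by positivity)
      (by field_simp; ring) ⟨R₀, hR₀, hR₀ε⟩ n, ?_⟩
    rintro l hl - ⟨R, hR, hRε⟩ g
    -- After `n` steps the coefficient of `T` is `β + n δ = 1/ε`, so `T ≤ ε P` cancels it and leaves
    -- frame operator `≤ c`.
    have h1 := hR.integral_norm_inner_sq_le hv hRε g
    rw [upperBarrier, hl, quadForm_sub, quadForm_add, quadForm_smul, quadForm_smul, quadForm_one,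
      quadForm_frameOp, quadForm_secondMoment hv, sub_add_cancel, ← div_le_iff₀' hε, div_div_eq_mul_div,
      mul_comm _ (1 + r), mul_div_right_comm] at h1
    linarith

/-- If `∫ v vᴴ = 1` in dimension at most `m`, then one can choose `n ≥ m` weighted points with frame
operator at least `n (1 - √((m - 1) / n))²`. -/
theorem exists_lowerStrategy [Nontrivial E] [FiniteDimensional ℂ E] {v : D → E} (hv : MemLp v 2 μ)
    (hiso : ∀ g : E, ∫ x, ‖inner ℂ (v x) g‖ ^ 2 ∂μ = ‖g‖ ^ 2) {m n : ℕ}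
    (hm : Module.finrank ℂ E ≤ m) (hmn : m ≤ n) :
    ∃ S, IsLowerStrategy μ n S ∧ ∀ l : List (D × ℝ), l.length = n → S l →
      ∀ g : E, n * (1 - √(((m : ℝ) - 1) / n)) ^ 2 * ‖g‖ ^ 2 ≤
        (l.map fun p => p.2 * ‖inner ℂ (v p.1) g‖ ^ 2).sum := by
  obtain ⟨g₀, hg₀⟩ := exists_ne (0 : E)
  have hinj : ∀ g : E, g ≠ 0 → 0 < ∫ x, ‖inner ℂ (v x) g‖ ^ 2 ∂μ := fun g hg => by
    rw [hiso]; positivity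
  have hv0 := not_ae_eq_zero_of_integral_pos (hinj g₀ hg₀)
  have hfin : 0 < Module.finrank ℂ E := Module.finrank_pos
  have hn' : (0 : ℝ) < n := by exact_mod_cast (by omega : 0 < n)
  have htr : ∫ x, ‖v x‖ ^ 2 ∂μ ≤ m := by
    have b := stdOrthonormalBasis ℂ E
    have h1 : ∀ x, ‖v x‖ ^ 2 = ∑ i, ‖inner ℂ (v x) (b i)‖ ^ 2 := fun x =>
      (b.sum_sq_norm_inner_left _).symm
    simp only [h1]
    rw [integral_finsetSum _ fun i _ => integrable_norm_inner_sq hv _]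
    simp only [hiso, b.orthonormal.1]
    simpa using hm
  -- For `m = 1` the barrier parameter `ε = s / (1 - s)` would vanish; the space is then a line and
  -- a scalar bound suffices.
  rcases (by omega : m = 1 ∨ 2 ≤ m) with rfl | hm2
  · refine ⟨_, norm_sq_isLowerStrategy (v := fun x => inner ℂ (v x) g₀ / (‖g₀‖ : ℂ)) ?_ ?_ n,
      fun l hl hS g => ?_⟩
    · simpa only [div_eq_inv_mul] using (hv.inner_const (𝕜 := ℂ) g₀).const_mul _
    · simp only [norm_div, div_pow, Complex.norm_real, norm_norm]
      rw [integral_div, hiso, div_self (by positivity)]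
    · have hdim : Module.finrank ℂ E = 1 := by omega
      obtain ⟨c, rfl⟩ := (finrank_eq_one_iff_of_nonzero' g₀ hg₀).1 hdim g
      rw [hl] at hS
      have h1 : ∀ p : D × ℝ, p.2 * ‖inner ℂ (v p.1) (c • g₀)‖ ^ 2 =
          (‖c‖ ^ 2 * ‖g₀‖ ^ 2) * (p.2 * ‖inner ℂ (v p.1) g₀ / (‖g₀‖ : ℂ)‖ ^ 2) := fun p => by
        have := norm_pos_iff.2 hg₀
        rw [inner_smul_right, norm_mul, norm_div, Complex.norm_real, norm_norm]
        field_simp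
      simp only [h1]
      rw [List.sum_map_mul_left, norm_smul]
      have : 0 ≤ ‖c‖ ^ 2 * ‖g₀‖ ^ 2 := by positivity
      calc _ = ‖c‖ ^ 2 * ‖g₀‖ ^ 2 * n := by norm_num; ring
        _ ≤ _ := mul_le_mul_of_nonneg_left hS this
  · set s := √(((m : ℝ) - 1) / n) with hs
    have hm2' : (2 : ℝ) ≤ m := by exact_mod_cast hm2
    have hmn' : (m : ℝ) ≤ n := by exact_mod_cast hmn
    have hs0 : 0 < s := Real.sqrt_pos.2 (div_pos (by linarith) hn')
    have hs2 : n * s ^ 2 = m - 1 := by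
      rw [hs, Real.sq_sqrt (div_nonneg (by linarith) hn'.le)]
      field_simp
    have hs1 : 0 < 1 - s := by
      have : s ^ 2 < 1 := by
        by_contra! h
        nlinarith
      nlinarith
    have hε : 0 < s / (1 - s) := by positivity
    have hκ : (0 : ℝ) < m / (s / (1 - s)) := by positivity
    have hP0 : lowerBarrier v (m / (s / (1 - s))) (1 - s) [] =
        ((m / (s / (1 - s)) : ℝ) : ℂ) • (1 : E →L[ℂ] E) := by
      simp [lowerBarrier, frameOp_nil]
    have hP : ∀ g, m / (s / (1 - s)) * ‖g‖ ^ 2 ≤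
        quadForm (lowerBarrier v (m / (s / (1 - s))) (1 - s) []) g := fun g => by
      rw [hP0, quadForm_smul, quadForm_one]
    have hPpos : (lowerBarrier v (m / (s / (1 - s))) (1 - s) [] : E →L[ℂ] E).IsPositive := by
      rw [hP0]
      refine ContinuousLinearMap.isPositive_one.smul_of_nonneg ?_
      exact_mod_cast hκ.le
    obtain ⟨R₀, hR₀⟩ := IsPosInverse.exists_of_coercive hPpos hκ hP
    have hR₀ε : ∫ x, quadForm R₀ (v x) ∂μ ≤ s / (1 - s) := by
      refine (hR₀.integral_quadForm_inv_le hκ hP hv).trans ?_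
      rw [div_le_iff₀ hκ]
      refine htr.trans_eq ?_
      field_simp
    refine ⟨_, barrier_isLowerStrategy hv hv0 hiso (c := m / (s / (1 - s))) (δ := 1 - s)
      (ε := s / (1 - s)) hs1 hε (by field_simp) ⟨R₀, hR₀, hR₀ε⟩ n, ?_⟩
    rintro l hl ⟨R, hR, hRε⟩ g
    have h1 := hR.integral_norm_inner_sq_le hv hRε g
    rw [hiso, lowerBarrier, hl, quadForm_add, quadForm_smul, quadForm_one, quadForm_frameOp,
      ← div_le_iff₀' hε] at h1
    -- From `1 ≤ ε P` the frame operator is at least `1/ε - m/ε + n δ`, which is `n (1 - s)²`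
    -- because `n s² = m - 1`.
    have h2 : n * (1 - s) ^ 2 * ‖g‖ ^ 2 = ‖g‖ ^ 2 / (s / (1 - s)) -
        (m / (s / (1 - s)) - n * (1 - s)) * ‖g‖ ^ 2 := by
      have : (m : ℝ) = n * s ^ 2 + 1 := by linarith
      rw [this]
      field_simp
      ring
    linarith

end ExistsStrategies

/-! ### Evaluation vectors in finite-dimensional subspaces of L² -/

section NormL2

variable {D : Type*} [MeasurableSpace D] {μ : Measure D}

lemma integral_norm_sq_eq_normL2_sq {f : D → ℂ} (hf : MemLp f 2 μ) :
    ∫ x, ‖f x‖ ^ 2 ∂μ = normL2 μ f ^ 2 := by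
  have h0 : 0 ≤ ∫ x, ‖f x‖ ^ 2 ∂μ := integral_nonneg fun x => by positivity
  rw [normL2, hf.eLpNorm_eq_integral_rpow_norm (by norm_num) (by norm_num)]
  simp only [ENNReal.toReal_ofNat, Real.rpow_ofNat]
  rw [ENNReal.toReal_ofReal (by positivity), ← Real.rpow_natCast, ← Real.rpow_mul h0]
  norm_num

/-- The point evaluations on a finite-dimensional subspace of `L²` can be represented, up to null
sets, by a square-integrable family of vectors of that subspace. -/
theorem exists_evaluation_family (W : Submodule ℂ (Lp ℂ 2 μ)) [FiniteDimensional ℂ W] :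
    ∃ a : D → W, MemLp a 2 μ ∧ ∀ g : W, ∀ᵐ x ∂μ, inner ℂ (a x) g = (g : Lp ℂ 2 μ) x := by
  let b := stdOrthonormalBasis ℂ W
  refine ⟨fun x => ∑ i, (starRingEnd ℂ) ((b i : Lp ℂ 2 μ) x) • b i, ?_, fun g => ?_⟩
  · refine memLp_finsetSum _ fun i _ => ?_
    have h1 : MemLp (fun x => (starRingEnd ℂ) ((b i : Lp ℂ 2 μ) x)) 2 μ :=
      (Lp.memLp (b i : Lp ℂ 2 μ)).star
    exact (ContinuousLinearMap.toSpanSingleton ℂ (b i)).comp_memLp' h1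
  · have h1 : (g : Lp ℂ 2 μ) = ∑ i, inner ℂ (b i) g • (b i : Lp ℂ 2 μ) := by
      conv_lhs => rw [← b.sum_repr' g]
      simp
    have h2 : ∀ᵐ x ∂μ, (∑ i, inner ℂ (b i) g • (b i : Lp ℂ 2 μ) : Lp ℂ 2 μ) x =
        ∑ i, (inner ℂ (b i) g • (b i : Lp ℂ 2 μ) : Lp ℂ 2 μ) x :=
      (Lp.coeFn_finsetSum _ _).trans (ae_of_all _ fun x => by simp)
    have h3 : ∀ᵐ x ∂μ, ∀ i, (inner ℂ (b i) g • (b i : Lp ℂ 2 μ) : Lp ℂ 2 μ) x =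
        inner ℂ (b i) g * (b i : Lp ℂ 2 μ) x :=
      ae_all_iff.2 fun i => Lp.coeFn_smul (inner ℂ (b i) g) (b i : Lp ℂ 2 μ)
    filter_upwards [h2, h3] with x hx2 hx3
    rw [h1, hx2, sum_inner]
    refine Finset.sum_congr rfl fun i _ => ?_
    rw [hx3]
    refine (inner_smul_left (𝕜 := ℂ) (b i) g _).trans ?_
    rw [Complex.conj_conj, mul_comm]

lemma integral_norm_sq_coeFn (g : Lp ℂ 2 μ) : ∫ x, ‖g x‖ ^ 2 ∂μ = ‖g‖ ^ 2 := by
  rw [integral_norm_sq_eq_normL2_sq (Lp.memLp g), normL2, Lp.norm_def]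

/-- The linear map that takes a function in `V` to its class in `L²`. -/
noncomputable def toLpLinear (V : Submodule ℂ (D → ℂ)) (hV : ∀ f ∈ V, MemLp f 2 μ) :
    V →ₗ[ℂ] Lp ℂ 2 μ where
  toFun f := (hV f f.2).toLp f
  map_add' f g := MemLp.toLp_add (hV f f.2) (hV g g.2)
  map_smul' c f := MemLp.toLp_const_smul c (hV f f.2)

/-- If almost every evaluation agrees with a given representation for each element, then, outside of
one null set, it agrees for all elements of a finite-dimensional space. -/
lemma ae_forall_eq_inner (V : Submodule ℂ (D → ℂ)) [FiniteDimensional ℂ V] {E : Type*}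
    [NormedAddCommGroup E] [InnerProductSpace ℂ E] (a : D → E) (φ : V →ₗ[ℂ] E)
    (h : ∀ f : V, ∀ᵐ x ∂μ, inner ℂ (a x) (φ f) = (f : D → ℂ) x) :
    ∀ᵐ x ∂μ, ∀ f : V, inner ℂ (a x) (φ f) = (f : D → ℂ) x := by
  let b := Module.finBasis ℂ V
  filter_upwards [ae_all_iff.2 fun i => h (b i)] with x hx f
  have : (innerSL ℂ (a x)).toLinearMap ∘ₗ φ = LinearMap.proj x ∘ₗ V.subtype :=
    b.ext fun i => by simpa using hx i
  simpa using LinearMap.congr_fun this f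

end NormL2

/-! ### Square-integrability of the kernel vectors -/

section KernelFamily

variable {D : Type*} (H : Type*) [NormedAddCommGroup H] [InnerProductSpace ℂ H]
  [CompleteSpace H] [RKHS ℂ H D ℂ]

/-- The Riesz representer `K(·, x)` of the evaluation at `x`. -/
noncomputable def kernelVec (x : D) : H := RKHS.kerFun H x (1 : ℂ)

variable {H} in
lemma inner_kernelVec (x : D) (g : H) : inner ℂ (kernelVec H x) g = g x := by
  simp [kernelVec]

lemma norm_kernelVec_sq (x : D) : ‖kernelVec H x‖ ^ 2 = kernelDiag H x := by
  have h := RKHS.kernel_inner H x x (1 : ℂ) (1 : ℂ)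
  have h2 : (inner ℂ (kernelVec H x) (kernelVec H x)).re = ‖kernelVec H x‖ ^ 2 :=
    inner_self_eq_norm_sq (𝕜 := ℂ) _
  rw [← h2, kernelVec, ← h]
  simp [kernelDiag]

variable [MeasurableSpace D] {μ : Measure D}

/-- If the kernel has finite trace and `H → L²` is injective, then `H` has a countable basis. -/
lemma countable_of_hilbertBasis (hL2 : ∀ g : H, MemLp g 2 μ)
    (hinj : ∀ g : H, g ≠ 0 → normL2 μ g ≠ 0) (htrace : Integrable (kernelDiag H) μ)
    {ι : Type*} (b : HilbertBasis ι ℂ H) : Countable ι := by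
  have hi : ∀ g : H, Integrable (fun x => ‖g x‖ ^ 2) μ := fun g =>
    (hL2 g).integrable_norm_pow (p := 2) (by norm_num)
  -- Bessel's inequality for `K(·, x)` bounds every partial sum by the trace. All terms are nonzero
  -- by injectivity, so the index set is countable.
  have hsum : Summable fun i => ∫ x, ‖b i x‖ ^ 2 ∂μ := by
    refine summable_of_sum_le (c := ∫ x, kernelDiag H x ∂μ)
      (fun i => integral_nonneg fun x => by positivity) fun F => ?_
    rw [← integral_finsetSum _ fun i _ => hi (b i)]
    refine integral_mono (integrable_finsetSum _ fun i _ => hi (b i)) htrace fun x => ?_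
    dsimp only
    rw [← norm_kernelVec_sq]
    refine le_trans (Finset.sum_le_sum fun i _ => ?_) (b.orthonormal.sum_inner_products_le _)
    rw [norm_inner_symm, inner_kernelVec]
  have hsupp : (Function.support fun i => ∫ x, ‖b i x‖ ^ 2 ∂μ) = Set.univ := by
    ext i
    simp only [Function.mem_support, Set.mem_univ, iff_true]
    rw [integral_norm_sq_eq_normL2_sq (hL2 _)]
    exact pow_ne_zero 2 (hinj _ (b.orthonormal.ne_zero i))
  have := hsum.countable_support
  rw [hsupp] at this
  exact Set.countable_univ_iff.1 this

/-- The norm is controlled by the trace. Measurability comes from expanding in a countable basis,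
whose coefficients are the measurable functions `conj (b i x)`. -/
lemma memLp_kernelVec (hL2 : ∀ g : H, MemLp g 2 μ)
    (hinj : ∀ g : H, g ≠ 0 → normL2 μ g ≠ 0) (htrace : Integrable (kernelDiag H) μ) :
    MemLp (kernelVec H) 2 μ := by
  have hmeas : AEStronglyMeasurable (kernelVec H) μ := by
    obtain ⟨w, b, -⟩ := exists_hilbertBasis ℂ H
    have := countable_of_hilbertBasis H hL2 hinj htrace b
    refine aestronglyMeasurable_of_tendsto_ae (Filter.atTop : Filter (Finset w))
      (f := fun F x => ∑ i ∈ F, b.repr (kernelVec H x) i • b i) (fun F => ?_)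
      (ae_of_all _ fun x => b.hasSum_repr (kernelVec H x))
    refine Finset.aestronglyMeasurable_fun_sum _ fun i _ => ?_
    have h1 : ∀ x, b.repr (kernelVec H x) i = (starRingEnd ℂ) (b i x) := fun x => by
      rw [b.repr_apply_apply, ← inner_conj_symm, inner_kernelVec]
    simp only [h1]
    exact (hL2 (b i)).1.star.smul_const _
  rw [memLp_two_iff_integrable_sq_norm hmeas]
  simpa only [norm_kernelVec_sq] using htrace

end KernelFamily

/-! ### Normalisation and assembly -/

lemma List.exists_eq_ofFn {α : Type*} {n : ℕ} {l : List α} (h : l.length = n) :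
    ∃ p : Fin n → α, l = List.ofFn p := by
  subst h
  exact ⟨l.get, (List.ofFn_get l).symm⟩

section EmbeddingConst

variable {D : Type*} [MeasurableSpace D] {μ : Measure D}
variable (H : Type*) [NormedAddCommGroup H] [InnerProductSpace ℂ H] [RKHS ℂ H D ℂ]

lemma normL2_sq_le_embeddingConst (hcont : BddAbove (embeddingRatios H μ)) (g : H) :
    normL2 μ g ^ 2 ≤ embeddingConst H μ * ‖g‖ ^ 2 := by
  rcases eq_or_ne g 0 with rfl | hg
  · simp [normL2]
  · rw [← div_le_iff₀ (by positivity)]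
    exact le_csSup hcont ⟨g, hg, rfl⟩

lemma embeddingConst_pos [Nontrivial H] (hcont : BddAbove (embeddingRatios H μ))
    (hinj : ∀ g : H, g ≠ 0 → normL2 μ g ≠ 0) : 0 < embeddingConst H μ := by
  obtain ⟨g, hg⟩ := exists_ne (0 : H)
  have h1 := normL2_sq_le_embeddingConst H hcont g
  have h2 : 0 < normL2 μ g ^ 2 := by have := hinj g hg; positivity
  by_contra! h
  nlinarith [mul_nonneg (neg_nonneg.2 h) (sq_nonneg ‖g‖)]

end EmbeddingConst

/-- A nonzero finite-dimensional subspace of `L²` that contains the classes of all functions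
in `V`. -/
lemma exists_submodule_Lp {D : Type*} [MeasurableSpace D] {μ : Measure D} {m : ℕ} (hm : 1 ≤ m)
    (V : Submodule ℂ (D → ℂ)) (hV : ∀ f ∈ V, MemLp f 2 μ) (hdim : Module.finrank ℂ V = m)
    {h : Lp ℂ 2 μ} (hh : h ≠ 0) :
    ∃ W : Submodule ℂ (Lp ℂ 2 μ), FiniteDimensional ℂ W ∧ Nontrivial W ∧
      Module.finrank ℂ W ≤ m ∧ ∀ f, toLpLinear V hV f ∈ W := by
  have : FiniteDimensional ℂ V := Module.finite_of_finrank_pos (by omega)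
  -- All functions in `V` may vanish a.e.; the line through `h` then supplies a nontrivial space of
  -- dimension at most `m`.
  by_cases hW : (toLpLinear V hV).range = ⊥
  · refine ⟨Submodule.span ℂ {h}, inferInstance, ?_, ?_, fun f => ?_⟩
    · exact ⟨⟨⟨h, Submodule.mem_span_singleton_self h⟩, 0, fun h0 => hh (congrArg Subtype.val h0)⟩⟩
    · rw [finrank_span_singleton hh]
      exact hm
    · have : toLpLinear V hV f ∈ (toLpLinear V hV).range := ⟨f, rfl⟩
      rw [hW, Submodule.mem_bot] at this
      rw [this]
      exact Submodule.zero_mem _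
  · refine ⟨(toLpLinear V hV).range, inferInstance, Submodule.nontrivial_iff_ne_bot.2 hW, ?_,
      fun f => ⟨f, rfl⟩⟩
    rw [← hdim]
    exact LinearMap.finrank_range_le _

theorem corollary2p1
    {D : Type*} [MeasurableSpace D] (μ : Measure D)
    (m n : ℕ) (hm : 1 ≤ m) (hmn : m ≤ n)
    -- an `m`-dimensional space of square-integrable functions
    (V : Submodule ℂ (D → ℂ)) (hV : ∀ f ∈ V, MemLp f 2 μ) (hdim : Module.finrank ℂ V = m)
    -- a nonzero reproducing kernel Hilbert space of functions on `D`
    (H : Type*) [NormedAddCommGroup H] [InnerProductSpace ℂ H] [CompleteSpace H] [Nontrivial H]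
    [RKHS ℂ H D ℂ]
    -- that is embedded in `L₂(D, μ)`, continuously and injectively, and has finite trace
    (hL2 : ∀ g : H, MemLp g 2 μ)
    (hcont : BddAbove (embeddingRatios H μ))
    (hinj : ∀ g : H, g ≠ 0 → normL2 μ g ≠ 0)
    (htrace : Integrable (kernelDiag H) μ) :
    ∃ (x : Fin n → D) (w : Fin n → ℝ), (∀ i, 0 < w i) ∧
      (∀ f ∈ V, (1 - √(((m : ℝ) - 1) / n)) * normL2 μ f ≤ √(∑ i, w i * ‖f (x i)‖ ^ 2)) ∧
      (∀ g : H, √(∑ i, w i * ‖g (x i)‖ ^ 2) ≤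
        (1 + √((effectiveDim H μ - 1) / n)) * √(embeddingConst H μ) * ‖g‖) := by
  have : FiniteDimensional ℂ V := Module.finite_of_finrank_pos (by omega)
  have hn : 0 < n := by omega
  have hn' : (0 : ℝ) < n := by exact_mod_cast hn
  have hlam := embeddingConst_pos H hcont hinj
  set lam := embeddingConst H μ with hlam_def
  have hK := memLp_kernelVec H hL2 hinj htrace
  -- the upper bound
  let v : D → H := fun x => ((√lam)⁻¹ : ℂ) • kernelVec H x
  have hv : MemLp v 2 μ := hK.const_smul _
  have hvg : ∀ x (g : H), ‖inner ℂ (v x) g‖ ^ 2 = lam⁻¹ * ‖g x‖ ^ 2 := fun x g => by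
    simp only [v]
    rw [inner_smul_left, inner_kernelVec, norm_mul, mul_pow, RCLike.norm_conj, norm_inv,
      Complex.norm_real, inv_pow, Real.norm_of_nonneg (Real.sqrt_nonneg _), Real.sq_sqrt hlam.le]
  have hvint : ∀ g : H, ∫ x, ‖inner ℂ (v x) g‖ ^ 2 ∂μ = lam⁻¹ * normL2 μ g ^ 2 := fun g => by
    simp only [hvg]
    rw [integral_const_mul, integral_norm_sq_eq_normL2_sq (hL2 g)]
  -- The factor `λ^(-1/2)` in `v` makes the second moment at most `1` and its trace exactly `M`.
  have hvtr : ∫ x, ‖v x‖ ^ 2 ∂μ = effectiveDim H μ := by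
    have h1 : ∀ x, ‖v x‖ ^ 2 = lam⁻¹ * kernelDiag H x := fun x => by
      simp only [v]
      rw [norm_smul, mul_pow, norm_kernelVec_sq, norm_inv, Complex.norm_real, inv_pow,
        Real.norm_of_nonneg (Real.sqrt_nonneg _), Real.sq_sqrt hlam.le]
    simp only [h1]
    rw [integral_const_mul, effectiveDim, kernelTrace, inv_mul_eq_div]
  obtain ⟨S, hS, hSn⟩ := exists_upperStrategy hv
    (fun g hg => by rw [hvint]; have := hinj g hg; positivity)
    (fun g => by
      rw [hvint, inv_mul_le_iff₀ hlam]
      exact normL2_sq_le_embeddingConst H hcont g) hn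
  rw [hvtr] at hSn
  -- the lower bound
  obtain ⟨h₀, hh₀⟩ := exists_ne (0 : H)
  have hh : (hL2 h₀).toLp h₀ ≠ 0 := by
    rw [← norm_ne_zero_iff, Lp.norm_toLp]
    exact hinj h₀ hh₀
  obtain ⟨W, hWfin, hWnt, hWm, hWV⟩ := exists_submodule_Lp hm V hV hdim hh
  obtain ⟨a, ha, hag⟩ := exists_evaluation_family W
  obtain ⟨T, hT, hTn⟩ := exists_lowerStrategy ha (fun g => by
    have h1 : ∫ x, ‖inner ℂ (a x) g‖ ^ 2 ∂μ = ∫ x, ‖(g : Lp ℂ 2 μ) x‖ ^ 2 ∂μ := by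
      refine integral_congr_ae ?_
      filter_upwards [hag g] with x hx
      rw [hx]
    rw [h1, integral_norm_sq_coeFn]
    rfl) hWm hmn
  -- Elements of `V` are functions, not classes: the points must avoid one null set common to all of
  -- `V`.
  have hG := ae_forall_eq_inner V a ((toLpLinear V hV).codRestrict W hWV) fun f => by
    filter_upwards [hag ((toLpLinear V hV).codRestrict W hWV f), (hV f f.2).coeFn_toLp] with x h1 h2
    rw [h1]
    exact h2
  -- the points
  obtain ⟨l, hl, hSl, hTl, hlG⟩ := exists_list_of_strategies hS hT hG
  have hup := hSn l hl (fun p hp => (hlG p hp).2) hSl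
  have hlow := hTn l hl hTl
  obtain ⟨p, rfl⟩ := List.exists_eq_ofFn hl
  have hp : ∀ i, _ := fun i => hlG (p i) (List.mem_ofFn.2 ⟨i, rfl⟩)
  simp only [List.map_ofFn, List.sum_ofFn, Function.comp_apply] at hup hlow
  refine ⟨fun i => (p i).1, fun i => (p i).2 / n, fun i => div_pos (hp i).2 hn', fun f hf => ?_,
    fun g => ?_⟩
  · have h1 := hlow ((toLpLinear V hV).codRestrict W hWV ⟨f, hf⟩)
    have h2 : ‖(toLpLinear V hV).codRestrict W hWV ⟨f, hf⟩‖ = normL2 μ f := Lp.norm_toLp f (hV f hf)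
    simp only [fun i => (hp i).1 ⟨f, hf⟩] at h1
    rw [h2, mul_assoc, ← le_div_iff₀' hn', ← mul_pow] at h1
    refine Real.le_sqrt_of_sq_le (h1.trans_eq ?_)
    rw [Finset.sum_div]
    exact Finset.sum_congr rfl fun i _ => by ring
  · have h1 := hup g
    simp only [hvg] at h1
    rw [Real.sqrt_le_iff]
    refine ⟨by positivity, ?_⟩
    have h2 : ∑ i, (p i).2 / n * ‖g (p i).1‖ ^ 2 =
        lam / n * ∑ i, (p i).2 * (lam⁻¹ * ‖g (p i).1‖ ^ 2) := by
      rw [Finset.mul_sum]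
      refine Finset.sum_congr rfl fun i _ => ?_
      field_simp
    rw [h2, mul_pow, mul_pow, Real.sq_sqrt hlam.le]
    refine (mul_le_mul_of_nonneg_left h1 (by positivity)).trans_eq ?_
    field_simp
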